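/- Let $G$ be a countable group, let $K$ be an uncountable algebraically closed field, let $X$ be an algebraic variety over $K$ (a reduced $K$-scheme of finite type), and let $A = X(K)$ be its set of $K$-points. The group $G$ acts on the set $A^G$ of configurations $c\colon G\to A$ by $(gc)(h)=c(g^{-1}h)$, and for $D\subset G$ we write $c|_D$ for the restriction of $c$ to $D$. Definitions. A subshift is a $G$-invariant subset of $A^G$. An algebraic cellular automaton is a map $\sigma\colon A^G\to A^G$ for which there are a finite subset $M\subset G$ and a morphism of $K$-schemes $f\colon X^M\to X$ (with $X^M$ the fibered product over $K$ of copies of $X$ indexed by $M$), inducing $\mu\colon A^M\to A$ on $K$-points, such that $\sigma(c)(g)=\mu((g^{-1}c)|_M)$ for all $c\in A^G$ and $g\in G$. An algebraic subshift of finite type is a set of the form $\{x\in A^G : (gx)|_D\in W \text{ for all } g\in G\}$, where $D\subset G$ is finite and $W\subset A^D$ is Zariski closed. An algebraic sofic subshift is a subshift of the form $\sigma'(\Sigma')$, where $\sigma'\colon A^G\to A^G$ is an algebraic cellular automaton and $\Sigma'\subset A^G$ is an algebraic subshift of finite type. A subshift $\Sigma\subset A^G$ is strongly irreducible if there is a finite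 subset $\Delta\subset G$ such that for all finite $E,F\subset G$ with $E\Delta\cap F=\varnothing$ and all $x,y\in\Sigma$ there is $z\in\Sigma$ with $z|_E=x|_E$ and $z|_F=y|_F$. Two configurations are asymptotic if they coincide outside some finite subset of $G$. A map $\tau\colon\Sigma\to\Sigma$ is post-surjective if for all $x,y\in\Sigma$ with $y$ asymptotic to $\tau(x)$ there is $z\in\Sigma$ asymptotic to $x$ with $\tau(z)=y$. Theorem. Let $\Sigma\subset A^G$ be a strongly irreducible algebraic sofic subshift, and let $\tau\colon\Sigma\to\Sigma$ be the restriction of some algebraic cellular automaton $\sigma\colon A^G\to A^G$. If $\tau$ is post-surjective, then $\tau$ is surjective. -/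

import Mathlib

open CategoryTheory CategoryTheory.Limits AlgebraicGeometry
open scoped Pointwise

universe u v w

namespace AlgCA

noncomputable section

/-! ### Configurations, subshifts and cellular automata over an arbitrary alphabet -/

section Shift

variable {G : Type v} [Group G] {A : Type w}

/-- The Bernoulli shift action on configurations: `(g c)(h) = c (g⁻¹ h)`. -/
def shift (g : G) (c : G → A) : G → A := fun h => c (g⁻¹ * h)

/-- The restriction `c|_D` of a configuration to a finite subset `D` of `G`. -/
def restr (D : Finset G) (c : G → A) : D → A := fun d => c d

/-- A subshift is a `G`-invariant set of configurations. -/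
def IsSubshift (S : Set (G → A)) : Prop :=
  ∀ (g : G), ∀ c ∈ S, shift g c ∈ S

/-- Two configurations are asymptotic if they agree outside some finite subset of `G`. -/
def Asymptotic (c d : G → A) : Prop :=
  ∃ E : Finset G, ∀ g, g ∉ E → c g = d g

/-- Strong irreducibility of a set of configurations. -/
def StronglyIrreducible (S : Set (G → A)) : Prop :=
  ∃ Δ : Finset G, ∀ E F : Finset G, Disjoint ((E : Set G) * (Δ : Set G)) (F : Set G) →
    ∀ x ∈ S, ∀ y ∈ S, ∃ z ∈ S, restr E z = restr E x ∧ restr F z = restr F y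

/-- `σ` is the cellular automaton with memory set `M` and local defining map `μ : A^M → A`. -/
def HasLocalMap (σ : (G → A) → (G → A)) (M : Finset G) (μ : (M → A) → A) : Prop :=
  ∀ (c : G → A) (g : G), σ c g = μ (restr M (shift g⁻¹ c))

/-- Post-surjectivity of a self-map of a set `S` of configurations. -/
def PostSurjective {S : Set (G → A)} (τ : S → S) : Prop :=
  ∀ x y : S, Asymptotic (y : G → A) (τ x : G → A) →
    ∃ z : S, Asymptotic (z : G → A) (x : G → A) ∧ τ z = y

end Shift

/-! ### Algebraic varieties and their rational points -/

section Variety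

variable {K : Type u} [Field K]

/-- An algebraic variety over `K` (which is algebraically closed in the uses below): a reduced
`K`-scheme of finite type. -/
structure IsAlgebraicVariety (X : Over (Spec (.of K))) : Prop where
  isReduced : IsReduced X.left
  locallyOfFiniteType : LocallyOfFiniteType X.hom
  quasiCompact : QuasiCompact X.hom

/-- The set `X(K)` of `K`-points of `X`: the sections of the structure morphism. -/
abbrev Points (X : Over (Spec (.of K))) : Type u :=
  Over.mk (𝟙 (Spec (.of K))) ⟶ X

/-- The underlying point of the scheme `X` of a `K`-point. -/
def Points.toPoint {X : Over (Spec (.of K))} (p : Points X) : X.left :=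
  p.left (IsLocalRing.closedPoint K)

/-- The fibered product `X^D` over `K` of copies of `X` indexed by a finite type `D`. -/
abbrev power (X : Over (Spec (.of K))) (D : Type v) [Finite D] : Over (Spec (.of K)) :=
  ∏ᶜ fun _ : D => X

/-- The identification `X(K)^D → X^D(K)`. -/
def tuple {X : Over (Spec (.of K))} {D : Type v} [Finite D] (a : D → Points X) :
    Points (power X D) :=
  Pi.lift a

/-- A subset `W` of `A^D`, where `A = X(K)`, is an algebraic subvariety if it is closed in the
Zariski topology, i.e. cut out on `K`-points by a closed subset of the scheme `X^D`. -/
def IsSubvariety {X : Over (Spec (.of K))} {D : Type v} [Finite D]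
    (W : Set (D → Points X)) : Prop :=
  ∃ Z : Set (power X D).left, IsClosed Z ∧ W = {a | (tuple a).toPoint ∈ Z}

end Variety

/-! ### Algebraic subshifts and algebraic cellular automata -/

section Algebraic

variable {G : Type v} [Group G] {K : Type u} [Field K] {X : Over (Spec (.of K))}

/-- The class `CA_alg(G, X, K)`: cellular automata over `X(K)` having a finite memory set `M`
whose local defining map is induced by a morphism of `K`-schemes `f : X^M → X`. -/
def IsAlgebraicCA (σ : (G → Points X) → (G → Points X)) : Prop :=
  ∃ (M : Finset G) (μ : (M → Points X) → Points X), HasLocalMap σ M μ ∧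
    ∃ f : power X M ⟶ X, ∀ a : M → Points X, μ a = tuple a ≫ f

/-- The set `Σ(A^G; W, D)` of configurations `x` with `(g x)|_D ∈ W` for all `g`. -/
def sftOf (D : Finset G) (W : Set (D → Points X)) : Set (G → Points X) :=
  {x | ∀ g : G, restr D (shift g x) ∈ W}

/-- Algebraic subshifts of finite type. -/
def IsAlgebraicSFT (S : Set (G → Points X)) : Prop :=
  ∃ (D : Finset G) (W : Set (D → Points X)), IsSubvariety W ∧ S = sftOf D W

/-- Algebraic sofic subshifts: subshifts that are images of an algebraic subshift of finite type
under an algebraic cellular automaton over the same alphabet. -/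
def IsAlgebraicSofic (S : Set (G → Points X)) : Prop :=
  IsSubshift S ∧ ∃ (σ : (G → Points X) → (G → Points X)) (S' : Set (G → Points X)),
    IsAlgebraicCA σ ∧ IsAlgebraicSFT S' ∧ S = σ '' S'

end Algebraic

end

end AlgCA

/-! Given `y` in the subshift and a finite set `E`, strong irreducibility glues `y` on `E` to `τ y`
far from `E`. The result is asymptotic to `τ y`, so post-surjectivity puts it in the image of `τ`:
the image is dense. It remains to see that the image is closed (`exists_eqOn`). Configurations are
specialized from one spectrum `Spec R`, with `R` countably generated over `K`. Prescribed values and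
the finite type condition cut out closed subsets, so quasi-compactness yields a point of their
intersection, and the Nullstellensatz over an uncountable field makes it a `K`-point. -/

namespace AlgCA

/-! ### Countably generated algebras -/

/-- The Nullstellensatz in countably many variables over an uncountable algebraically closed
field. -/
theorem algebraMap_quotient_bijective {K : Type u} [Field K] [IsAlgClosed K] [Uncountable K]
    {R : Type u} [CommRing R] [Algebra K R] {ι : Type*} [Countable ι]
    (π : MvPolynomial ι K →ₐ[K] R) (hπ : Function.Surjective π) (m : Ideal R) [m.IsMaximal] :
    Function.Bijective (algebraMap K (R ⧸ m)) := by
  let : Field (R ⧸ m) := Ideal.Quotient.field m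
  have hrank : Module.rank K (R ⧸ m) ≤ Cardinal.aleph0 := by
    have hs : Function.Surjective ((Ideal.Quotient.mkₐ K m).comp π).toLinearMap :=
      (Ideal.Quotient.mkₐ_surjective K m).comp hπ
    have h1 := LinearMap.lift_rank_le_of_surjective _ hs
    have h2 : Module.rank K (MvPolynomial ι K) ≤ Cardinal.aleph0 := by
      rw [MvPolynomial.rank_eq_lift]
      simp
    simpa using h1.trans (Cardinal.lift_le.2 h2)
  have halg : Algebra.IsAlgebraic K (R ⧸ m) := by
    refine ⟨fun x => ?_⟩
    by_contra hx
    -- For transcendental `x`, the uncountably many `(x - a)⁻¹` with `a` in `K` are independent,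
    -- against countable dimension.
    have hle := (Transcendental.linearIndependent_sub_inv hx).cardinal_le_rank
    exact (Cardinal.aleph0_lt_mk_iff.2 ‹Uncountable K›).not_ge (hle.trans hrank)
  exact IsAlgClosed.algebraMap_bijective_of_isIntegral

/-- A countable coproduct of copies of an algebra of finite type, presented by countably many
generators. -/
theorem exists_countable_coproduct (K B : Type u) [Field K] [CommRing B] [Algebra K B]
    [Algebra.FiniteType K B] :
    ∃ (ι : Type) (_ : Countable ι) (R : Type u) (_ : CommRing R) (_ : Algebra K R)
      (π : MvPolynomial ι K →ₐ[K] R) (i : ℕ → B →ₐ[K] R), Function.Surjective π ∧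
      ∀ h : ℕ → B →ₐ[K] K, ∃ H : R →ₐ[K] K, ∀ n, H.comp (i n) = h n := by
  obtain ⟨k, φ, hφ⟩ := Algebra.FiniteType.iff_quotient_mvPolynomial''.1
    (inferInstance : Algebra.FiniteType K B)
  let r (n : ℕ) : MvPolynomial (Fin k) K →ₐ[K] MvPolynomial (ℕ × Fin k) K :=
    MvPolynomial.rename (Prod.mk n)
  let I : Ideal (MvPolynomial (ℕ × Fin k) K) := ⨆ n, (RingHom.ker φ).map (r n)
  have hker (n : ℕ) : ∀ a ∈ RingHom.ker φ, (Ideal.Quotient.mkₐ K I).comp (r n) a = 0 :=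
    fun a ha => Ideal.Quotient.eq_zero_iff_mem.2
      (Ideal.mem_iSup_of_mem n (Ideal.mem_map_of_mem _ ha))
  let e := Ideal.quotientKerAlgEquivOfSurjective hφ
  refine ⟨ℕ × Fin k, inferInstance, _ ⧸ I, inferInstance, inferInstance, Ideal.Quotient.mkₐ K I,
    fun n => (Ideal.Quotient.liftₐ _ _ (hker n)).comp e.symm.toAlgHom,
    Ideal.Quotient.mkₐ_surjective K I, fun h => ?_⟩
  let ψ : MvPolynomial (ℕ × Fin k) K →ₐ[K] K :=
    MvPolynomial.aeval fun x => h x.1 (φ (MvPolynomial.X x.2))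
  have hψ (n : ℕ) : ψ.comp (r n) = (h n).comp φ := by
    ext j
    simp [ψ, r]
  have hI : ∀ a ∈ I, ψ a = 0 := by
    suffices I ≤ RingHom.ker ψ from this
    refine iSup_le fun n => Ideal.map_le_iff_le_comap.2 fun a ha => ?_
    have := DFunLike.congr_fun (hψ n) a
    simpa [RingHom.mem_ker.1 ha] using this
  refine ⟨Ideal.Quotient.liftₐ I ψ hI, fun n => ?_⟩
  ext b
  obtain ⟨a, rfl⟩ := hφ b
  have he : e.symm (φ a) = Ideal.Quotient.mk _ a := by
    rw [AlgEquiv.symm_apply_eq]; rfl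
  have := DFunLike.congr_fun (hψ n) a
  change Ideal.Quotient.liftₐ I ψ hI (Ideal.Quotient.liftₐ _ _ (hker n) (e.symm (φ a))) = _
  rw [he]
  exact this

/-! ### `K`-points and the universal configuration -/

section Points

variable {K : Type u} [Field K]

/-- The spectrum of a `K`-algebra as a scheme over `K`. -/
noncomputable def specOver (K : Type u) [Field K] (B : Type u) [CommRing B] [Algebra K B] :
    Over (Spec (.of K)) :=
  Over.mk (Spec.map (CommRingCat.ofHom (algebraMap K B)))

/-- The morphism of spectra induced by a homomorphism of `K`-algebras. -/
noncomputable def specOverMap {B C : Type u} [CommRing B] [Algebra K B] [CommRing C] [Algebra K C]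
    (φ : B →ₐ[K] C) : specOver K C ⟶ specOver K B :=
  Over.homMk (Spec.map (CommRingCat.ofHom φ.toRingHom)) (by
    simp only [specOver, Over.mk_hom, ← Spec.map_comp, ← CommRingCat.ofHom_comp]
    congr 2
    exact φ.comp_algebraMap)

/-- The `K`-point given by a homomorphism of `K`-algebras to `K`. -/
noncomputable def pointOfAlgHom {B : Type u} [CommRing B] [Algebra K B] (φ : B →ₐ[K] K) :
    Points (specOver K B) :=
  Over.homMk (Spec.map (CommRingCat.ofHom φ.toRingHom)) (by
    simp only [specOver, Over.mk_hom, ← Spec.map_comp, ← CommRingCat.ofHom_comp]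
    rw [← Spec.map_id]
    congr 2
    exact φ.comp_algebraMap)

theorem pointOfAlgHom_surjective {B : Type u} [CommRing B] [Algebra K B] :
    Function.Surjective (pointOfAlgHom (K := K) (B := B)) := by
  intro p
  obtain ⟨f, hf⟩ := Spec.map_surjective p.left
  have hw : Spec.map (CommRingCat.ofHom (algebraMap K B) ≫ f) = Spec.map (𝟙 _) := by
    rw [Spec.map_comp, hf, Spec.map_id]
    exact Over.w p
  have h := Spec.map_injective hw
  refine ⟨⟨f.hom, fun r => ?_⟩, ?_⟩
  · exact ConcreteCategory.congr_hom h r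
  · ext1
    exact hf

theorem pointOfAlgHom_comp {B C : Type u} [CommRing B] [Algebra K B] [CommRing C] [Algebra K C]
    (ψ : C →ₐ[K] K) (φ : B →ₐ[K] C) :
    pointOfAlgHom ψ ≫ specOverMap φ = pointOfAlgHom (ψ.comp φ) := by
  ext1
  exact (Spec.map_comp _ _).symm

theorem Points.toPoint_comp {X Y : Over (Spec (.of K))} (p : Points X) (f : X ⟶ Y) :
    Points.toPoint (p ≫ f) = f.left p.toPoint := by
  rfl

variable [IsAlgClosed K]

theorem Points.isClosed_toPoint {X : Over (Spec (.of K))} [LocallyOfFiniteType X.hom]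
    (p : Points X) : IsClosed {p.toPoint} :=
  (pointEquivClosedPoint X.hom ⟨p.left, Over.w p⟩).2

theorem Points.toPoint_injective {X : Over (Spec (.of K))} [LocallyOfFiniteType X.hom] :
    Function.Injective (Points.toPoint (X := X)) := by
  intro p q h
  ext1
  exact ext_of_apply_closedPoint_eq X.hom (Over.w p) (Over.w q) h

theorem Points.exists_toPoint_eq {X : Over (Spec (.of K))} [LocallyOfFiniteType X.hom]
    {x : X.left} (hx : IsClosed {x}) : ∃ p : Points X, p.toPoint = x :=
  ⟨Over.homMk (pointOfClosedPoint X.hom x hx) (pointOfClosedPoint_comp X.hom x hx),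
    pointOfClosedPoint_apply X.hom x hx _⟩

/-- A scheme of finite type over `K` is dominated by an affine one, surjectively on `K`-points. -/
theorem exists_specOver_hom (X : Over (Spec (.of K))) [LocallyOfFiniteType X.hom]
    [QuasiCompact X.hom] :
    ∃ (B : Type u) (_ : CommRing B) (_ : Algebra K B) (_ : Algebra.FiniteType K B)
      (q : specOver K B ⟶ X), ∀ x : Points X, ∃ v : Points (specOver K B), v ≫ q = x := by
  have : CompactSpace X.left := QuasiCompact.compactSpace_of_compactSpace X.hom
  have : IsZariskiLocalAtSource @LocallyOfFiniteType.{u} :=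
    HasRingHomProperty.instIsZariskiLocalAtSource
  have : MorphismProperty.ContainsIdentities @LocallyOfFiniteType.{u} :=
    MorphismProperty.IsMultiplicative.toContainsIdentities
  obtain ⟨V, q, hq, hfin, hV⟩ :=
    X.left.exists_hom_isAffine_of_isZariskiLocalAtSource @LocallyOfFiniteType
  let B : CommRingCat.{u} := Γ(V, ⊤)
  let q' : Spec B ⟶ X.left := V.isoSpec.inv ≫ q
  have hq' : Surjective q' := inferInstance
  have hfin' : LocallyOfFiniteType q' := inferInstance
  have hcomp : LocallyOfFiniteType (q' ≫ X.hom) := locallyOfFiniteType_comp q' X.hom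
  obtain ⟨s, hs⟩ := Spec.map_surjective (q' ≫ X.hom)
  let _ : Algebra K B := s.hom.toAlgebra
  have hsB : (specOver K B).hom = q' ≫ X.hom := hs
  have hlft : LocallyOfFiniteType (specOver K B).hom := by
    rw [hsB]; exact hcomp
  have hB : Algebra.FiniteType K B := by
    have : LocallyOfFiniteType (Spec.map s) := hs ▸ hcomp
    exact (HasRingHomProperty.Spec_iff (P := @LocallyOfFiniteType)).1 this
  refine ⟨B, inferInstance, inferInstance, hB, Over.homMk q' hsB.symm, fun x => ?_⟩
  -- A `K`-point is lifted by choosing a closed point in its fibre, which is closed and nonempty.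
  have hcl : IsClosed (q' ⁻¹' {x.toPoint}) := x.isClosed_toPoint.preimage q'.continuous
  obtain ⟨y, hy⟩ := hq'.surj x.toPoint
  obtain ⟨v, hv, hvcl⟩ := hcl.exists_closed_singleton ⟨y, hy⟩
  obtain ⟨p, rfl⟩ := Points.exists_toPoint_eq (X := specOver K B) hvcl
  exact ⟨p, Points.toPoint_injective ((p.toPoint_comp _).trans hv)⟩

/-- The universal configuration: a compact `K`-scheme `T` with a family of `T`-points of `X` that
specializes to every configuration over `X(K)`, and all of whose nonempty closed subsets contain
`K`-points. -/
theorem exists_universal_configuration [Uncountable K] (G : Type v) [Countable G] [Nonempty G]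
    (X : Over (Spec (.of K))) [LocallyOfFiniteType X.hom] [QuasiCompact X.hom] :
    ∃ (T : Over (Spec (.of K))) (p : G → (T ⟶ X)), CompactSpace T.left ∧
      (∀ Z : Set T.left, IsClosed Z → Z.Nonempty → ∃ t : Points T, t.toPoint ∈ Z) ∧
      ∀ c : G → Points X, ∃ t : Points T, ∀ g, t ≫ p g = c g := by
  obtain ⟨B, _, _, _, q, hq⟩ := exists_specOver_hom X
  obtain ⟨ι, _, R, _, _, π, i, hπ, hi⟩ := exists_countable_coproduct K B
  obtain ⟨e, he⟩ := exists_injective_nat G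
  have hcompact : CompactSpace (specOver K R).left :=
    inferInstanceAs (CompactSpace (PrimeSpectrum R))
  refine ⟨specOver K R, fun g => specOverMap (i (e g)) ≫ q, hcompact, fun Z hZ hne => ?_,
    fun c => ?_⟩
  · obtain ⟨m, hm, hmcl⟩ := hZ.exists_closed_singleton hne
    have hmax : m.asIdeal.IsMaximal := (PrimeSpectrum.isClosed_singleton_iff_isMaximal m).1 hmcl
    let a : K ≃ₐ[K] R ⧸ m.asIdeal :=
      AlgEquiv.ofBijective (Algebra.ofId _ _) (algebraMap_quotient_bijective π hπ m.asIdeal)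
    let ψ : R →ₐ[K] K := a.symm.toAlgHom.comp (Ideal.Quotient.mkₐ K m.asIdeal)
    refine ⟨pointOfAlgHom ψ, ?_⟩
    convert hm
    refine PrimeSpectrum.ext (Ideal.ext fun r => ?_)
    change ψ r ∈ IsLocalRing.maximalIdeal K ↔ _
    rw [IsLocalRing.maximalIdeal_eq_bot, Ideal.mem_bot]
    change a.symm (Ideal.Quotient.mk _ r) = 0 ↔ _
    rw [map_eq_zero_iff _ a.symm.injective, Ideal.Quotient.eq_zero_iff_mem]
  · choose v hv using fun g => hq (c g)
    choose φ hφ using fun g => pointOfAlgHom_surjective (v g)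
    -- Indices outside the range of `e` receive an arbitrary value, which no `p g` sees.
    obtain ⟨H, hH⟩ := hi fun n => φ (Function.invFun e n)
    refine ⟨pointOfAlgHom H, fun g => ?_⟩
    rw [← Category.assoc, pointOfAlgHom_comp, hH, Function.leftInverse_invFun he, hφ, hv]

end Points

/-! ### Closedness of images -/

section Configurations

variable {G : Type v} {K : Type u} [Field K] {X : Over (Spec (.of K))}

/-- A self-map of the space of configurations that acts on every family of `T`-points of `X`,
compatibly with specialization at `K`-points. -/
def IsSchematic (σ : (G → Points X) → (G → Points X)) : Prop :=
  ∀ (T : Over (Spec (.of K))) (p : G → (T ⟶ X)), ∃ q : G → (T ⟶ X), ∀ (t : Points T) (g : G),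
    σ (fun h => t ≫ p h) g = t ≫ q g

theorem comp_tuple {T : Over (Spec (.of K))} {D : Type v} [Finite D] (p : D → (T ⟶ X))
    (t : Points T) : tuple (fun d => t ≫ p d) = t ≫ (Pi.lift p : T ⟶ power X D) := by
  apply Pi.hom_ext
  intro d
  simp [tuple]

theorem IsAlgebraicCA.isSchematic [Group G] {σ : (G → Points X) → (G → Points X)} (hσ : IsAlgebraicCA σ) :
    IsSchematic σ := by
  obtain ⟨M, μ, hμ, f, hf⟩ := hσ
  intro T p
  refine ⟨fun g => (Pi.lift (fun m : M => p (g * m)) : T ⟶ power X M) ≫ f, fun t g => ?_⟩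
  have h : restr M (shift g⁻¹ fun h => t ≫ p h) = fun m : M => t ≫ p (g * m) := by
    funext m
    simp only [restr, shift, inv_inv]
  rw [hμ, hf, h, comp_tuple, Category.assoc]

theorem IsSchematic.comp {σ ρ : (G → Points X) → (G → Points X)} (hσ : IsSchematic σ)
    (hρ : IsSchematic ρ) : IsSchematic (σ ∘ ρ) := by
  intro T p
  obtain ⟨q, hq⟩ := hρ T p
  obtain ⟨r, hr⟩ := hσ T q
  refine ⟨r, fun t g => ?_⟩
  rw [← hr, Function.comp_apply]
  exact congrFun (congrArg σ (funext fun h => hq t h)) g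

/-- The image of an algebraic subshift of finite type is closed in the prodiscrete topology, even
after restriction to a subset of the group. -/
theorem IsAlgebraicSFT.exists_eqOn [Group G] [Countable G] [IsAlgClosed K] [Uncountable K]
    [LocallyOfFiniteType X.hom] [QuasiCompact X.hom] {S : Set (G → Points X)}
    (hS : IsAlgebraicSFT S) {σ : (G → Points X) → (G → Points X)} (hσ : IsSchematic σ)
    (H : Set G) (y : G → Points X)
    (hy : ∀ E : Finset G, (E : Set G) ⊆ H → ∃ x ∈ S, ∀ g ∈ E, σ x g = y g) :
    ∃ x ∈ S, ∀ g ∈ H, σ x g = y g := by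
  classical
  obtain ⟨D, W, ⟨Z, hZ, rfl⟩, rfl⟩ := hS
  obtain ⟨T, p, _, hT, hp⟩ := exists_universal_configuration G X
  obtain ⟨q, hq⟩ := hσ T p
  let r (g : G) : T ⟶ power X D := Pi.lift fun d : D => p (g⁻¹ * d)
  have hr (t : Points T) (g : G) :
      tuple (restr D (shift g fun h => t ≫ p h)) = t ≫ r g := comp_tuple _ t
  let C : Set T.left := ⋂ g, (r g).left ⁻¹' Z
  have hC : IsClosed C := isClosed_iInter fun g => hZ.preimage (r g).left.continuous
  let F (g : H) : Set T.left := (q g).left ⁻¹' {(y g).toPoint}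
  have hF (g : H) : IsClosed (F g) := (y g).isClosed_toPoint.preimage (q g).left.continuous
  have hmemC (t : Points T) : t.toPoint ∈ C ↔
      (fun h => t ≫ p h) ∈ sftOf D {a : D → Points X | (tuple a).toPoint ∈ Z} := by
    simp only [C, sftOf, Set.mem_iInter, Set.mem_preimage, Set.mem_ofPred_eq, hr,
      Points.toPoint_comp]
  have hmemF (t : Points T) (g : H) : t.toPoint ∈ F g ↔ σ (fun h => t ≫ p h) g = y g := by
    rw [hq, ← Points.toPoint_injective.eq_iff, Points.toPoint_comp]
    rfl
  obtain ⟨z, hz⟩ : (C ∩ ⋂ g, F g).Nonempty := by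
    -- By compactness only finitely many prescribed values matter, and `hy` realizes those.
    refine hC.isCompact.inter_iInter_nonempty F hF fun E => ?_
    obtain ⟨x, hx, hxy⟩ := hy (E.image Subtype.val) (by simp)
    obtain ⟨t, ht⟩ := hp x
    obtain rfl : (fun h => t ≫ p h) = x := funext ht
    refine ⟨t.toPoint, (hmemC t).2 hx, Set.mem_iInter₂.2 fun g hg => (hmemF t g).2 ?_⟩
    exact hxy g (Finset.mem_image_of_mem _ hg)
  obtain ⟨t, ht⟩ := hT _ (hC.inter (isClosed_iInter hF)) ⟨z, hz⟩
  exact ⟨_, (hmemC t).1 ht.1, fun g hg => (hmemF t ⟨g, hg⟩).1 (Set.mem_iInter.1 ht.2 ⟨g, hg⟩)⟩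

end Configurations

end AlgCA

/-! ### Post-surjectivity implies surjectivity -/

theorem mainTheorem3 {G : Type v} [Group G] [Countable G]
    {K : Type u} [Field K] [IsAlgClosed K] [Uncountable K]
    (X : Over (Spec (.of K))) (hX : AlgCA.IsAlgebraicVariety X)
    (S : Set (G → AlgCA.Points X))
    (hsofic : AlgCA.IsAlgebraicSofic S) (hirr : AlgCA.StronglyIrreducible S)
    (σ : (G → AlgCA.Points X) → (G → AlgCA.Points X)) (hσ : AlgCA.IsAlgebraicCA σ)
    (τ : S → S) (hτ : ∀ x : S, (τ x : G → AlgCA.Points X) = σ x)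
    (hpost : AlgCA.PostSurjective τ) :
    Function.Surjective τ := by
  classical
  have := hX.locallyOfFiniteType
  have := hX.quasiCompact
  obtain ⟨-, ρ, S', hρ, hS', rfl⟩ := hsofic
  obtain ⟨Δ, hΔ⟩ := hirr
  intro y
  obtain ⟨x, hx, hxy⟩ := hS'.exists_eqOn (hσ.isSchematic.comp hρ.isSchematic) Set.univ y
    fun E _ => by
    let w : G → AlgCA.Points X := fun g => if g ∈ E then y.1 g else (τ y).1 g
    -- Strong irreducibility glues on finite sets only; closedness extends this to the whole
    -- complement of `E * Δ`. Values on the rest of `E * Δ` stay free.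
    obtain ⟨u, hu, huw⟩ := hS'.exists_eqOn hρ.isSchematic
      ((E : Set G) ∪ ((E : Set G) * (Δ : Set G))ᶜ) w fun F hF => by
      -- `Δ` need not contain `1`, so `F` may meet `E` even off `E * Δ`; on `E` the value of `y`
      -- takes precedence.
      obtain ⟨z, ⟨u, hu, rfl⟩, hzE, hzF⟩ := hΔ E (F \ E)
        (Set.disjoint_left.2 fun g hg hgF => by
          rw [Finset.coe_sdiff] at hgF
          exact (hF hgF.1).elim hgF.2 fun h => h hg) y y.2 (τ y) (τ y).2
      refine ⟨u, hu, fun g hg => ?_⟩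
      by_cases hgE : g ∈ E
      · exact (congrFun hzE ⟨g, hgE⟩).trans (if_pos hgE).symm
      · exact (congrFun hzF ⟨g, Finset.mem_sdiff.2 ⟨hg, hgE⟩⟩).trans (if_neg hgE).symm
    let z : ρ '' S' := ⟨ρ u, u, hu, rfl⟩
    obtain ⟨⟨_, x, hx, rfl⟩, -, hxz⟩ := hpost y z ⟨E ∪ E * Δ, fun g hg => by
      rw [Finset.mem_union, not_or] at hg
      refine (huw g (Or.inr ?_)).trans (if_neg hg.1)
      rw [← Finset.coe_mul]
      exact hg.2⟩
    refine ⟨x, hx, fun g hg => ?_⟩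
    have h : σ (ρ x) = ρ u := (hτ _).symm.trans (congrArg Subtype.val hxz)
    exact (congrFun h g).trans ((huw g (Or.inl hg)).trans (if_pos hg))
  refine ⟨⟨ρ x, x, hx, rfl⟩, Subtype.ext ?_⟩
  rw [hτ]
  exact funext fun g => hxy g trivial
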